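/- Let $m,n,C\ge 0$ be integers and $q=\max\{m,n\}$. The deterministic Z-interference channel (Z-IC) with unidirectional cooperation has, in each channel use, inputs $\mathbf x_1\in\mathbb F_2^{m}$ and $\mathbf x_2\in\mathbb F_2^{q}$ and outputs $$\mathbf y_1=\mathbf D^{q-m}\mathbf x_1\oplus \mathbf D^{q-n}\mathbf x_2\in\mathbb F_2^{q},\qquad \mathbf y_2=\mathbf D^{q-m}\mathbf x_2\in\mathbb F_2^{m},$$ where $\mathbf D$ is the $q\times q$ downshift matrix, $\mathbf x_1$ is extended to length $q$ by zeros at the bottom, and the $q-m$ top entries of $\mathbf D^{q-m}\mathbf x_2$, which are always zero, are dropped. Transmitter 2 also sends $C$ bits $\mathbf v_{21}(t)$ per channel use to transmitter 1 over a noiseless secure link. A code of block length $N$ consists of: independent messages $W_1,W_2$, uniform on finite sets of sizes $M_1,M_2$; private randomness at each transmitter with an arbitrary distribution on a finite set, independent of the messages and of the other transmitter's randomness; an encoder of transmitter 2, by which $\mathbf x_2^N$ and $\mathbf v_{21}^N$ are functions of $W_2$ and its private randomness; a causal encoder of transmitter 1, by which $\mathbf x_1(t)$ is a function of $W_1$,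 its private randomness and $\mathbf v_{21}(1),\dots,\mathbf v_{21}(t)$; and decoders estimating $W_i$ from $\mathbf y_i^N$, $i=1,2$. A rate pair $(R_1,R_2)$ with $R_1,R_2\ge 0$ is achievable under a secrecy constraint if there is a sequence of codes, one for each $N$, with $M_i\ge 2^{NR_i}$ for $i=1,2$, such that the probability that at least one receiver decodes wrongly tends to $0$ as $N\to\infty$ and the secrecy constraint holds. For $(i,j)=(1,2)$ and $(i,j)=(2,1)$ the secrecy constraint requires * perfect secrecy: $I(W_i;\mathbf y_j^N)=0$ for every $N$; * strong secrecy: $I(W_i;\mathbf y_j^N)\to 0$ as $N\to\infty$; * weak secrecy: $\frac1N I(W_i;\mathbf y_j^N)\to 0$ as $N\to\infty$. Let $\mathcal C^{\text{perfect}},\mathcal C^{\text{strong}},\mathcal C^{\text{weak}}\subseteq\mathbb R^2$ be the corresponding capacity regions, that is, the closures of the sets of achievable rate pairs. Then $$\mathcal C^{\text{perfect}}=\mathcal C^{\text{strong}}=\mathcal C^{\text{weak}}.$$ -/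

import Mathlib

namespace ZIC

/-! ### Finite probability: entropy and mutual information -/

section Information

variable {Ω α β : Type*} [Fintype Ω] [DecidableEq α] [DecidableEq β]

/-- The probability that `X = x`, where `p` is the probability mass function on `Ω`. -/
noncomputable def prob (p : Ω → ℝ) (X : Ω → α) (x : α) : ℝ :=
  ∑ ω, if X ω = x then p ω else 0

/-- The Shannon entropy, in bits, of the random variable `X`. -/
noncomputable def entropy [Fintype α] (p : Ω → ℝ) (X : Ω → α) : ℝ :=
  (∑ x, Real.negMulLog (prob p X x)) / Real.log 2

/-- The mutual information `I(X; Y) = H(X) + H(Y) - H(X, Y)`, in bits. -/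
noncomputable def mutualInfo [Fintype α] [Fintype β] (p : Ω → ℝ) (X : Ω → α) (Y : Ω → β) : ℝ :=
  entropy p X + entropy p Y - entropy p (fun ω => (X ω, Y ω))

end Information

/-! ### The linear deterministic Z-interference channel -/

/-- The `q × q` downshift matrix over the field with two elements. -/
def downshift (q : ℕ) : Matrix (Fin q) (Fin q) (ZMod 2) :=
  Matrix.of fun i j => if (i : ℕ) = (j : ℕ) + 1 then 1 else 0

/-- A vector of length `m` seen as a vector of length `q` (zeros are appended at the bottom). -/
def pad {m : ℕ} (q : ℕ) (x : Fin m → ZMod 2) : Fin q → ZMod 2 :=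
  fun i => if h : (i : ℕ) < m then x ⟨i, h⟩ else 0

/-- The output at receiver 1, `y₁ = D ^ (q - m) x₁ ⊕ D ^ (q - n) x₂` with `q = max m n`. -/
def output₁ (m n : ℕ) (x₁ : Fin m → ZMod 2) (x₂ : Fin (max m n) → ZMod 2) :
    Fin (max m n) → ZMod 2 :=
  (downshift (max m n) ^ (max m n - m)).mulVec (pad (max m n) x₁) +
    (downshift (max m n) ^ (max m n - n)).mulVec x₂

/-- The output at receiver 2, `y₂ = D ^ (q - m) x₂` with `q = max m n`.  The first `q - m` entries
of this vector always vanish; `y₂` consists of the `m` last ones. -/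
def output₂ (m n : ℕ) (x₂ : Fin (max m n) → ZMod 2) : Fin m → ZMod 2 :=
  fun i => (downshift (max m n) ^ (max m n - m)).mulVec x₂
    ⟨(max m n - m) + i, by have := i.isLt; have := le_max_left m n; omega⟩

/-! ### Codes -/

/-- A code of block length `N` for the deterministic Z-interference channel with parameters `m`,
`n`, and with a noiseless link of `C` bits per channel use from transmitter 2 to transmitter 1.
Each transmitter has private randomness, with an arbitrary distribution on a finite set. -/
structure Code (m n C N : ℕ) where
  /-- The number of messages of user 1. -/
  M₁ : ℕ
  /-- The number of messages of user 2. -/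
  M₂ : ℕ
  M₁_pos : 0 < M₁
  M₂_pos : 0 < M₂
  /-- The number of values of the private randomness of transmitter 1. -/
  K₁ : ℕ
  /-- The number of values of the private randomness of transmitter 2. -/
  K₂ : ℕ
  /-- The distribution of the private randomness of transmitter 1. -/
  ρ₁ : Fin K₁ → ℝ
  /-- The distribution of the private randomness of transmitter 2. -/
  ρ₂ : Fin K₂ → ℝ
  ρ₁_mem : ρ₁ ∈ stdSimplex ℝ (Fin K₁)
  ρ₂_mem : ρ₂ ∈ stdSimplex ℝ (Fin K₂)
  /-- The signal sent by transmitter 2 over the cooperative link. -/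
  coop : Fin M₂ → Fin K₂ → Fin N → Fin C → ZMod 2
  /-- The encoder of transmitter 2. -/
  enc₂ : Fin M₂ → Fin K₂ → Fin N → Fin (max m n) → ZMod 2
  /-- The encoder of transmitter 1, whose last arguments are the signal received over the
  cooperative link and the time. -/
  enc₁ : Fin M₁ → Fin K₁ → (Fin N → Fin C → ZMod 2) → Fin N → Fin m → ZMod 2
  /-- Causality: the input at time `t` does not depend on the link signal after time `t`. -/
  causal : ∀ w k v v' t, (∀ s ≤ t, v s = v' s) → enc₁ w k v t = enc₁ w k v' t
  /-- The decoder of receiver 1. -/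
  dec₁ : (Fin N → Fin (max m n) → ZMod 2) → Fin M₁
  /-- The decoder of receiver 2. -/
  dec₂ : (Fin N → Fin m → ZMod 2) → Fin M₂

namespace Code

variable {m n C N : ℕ} (c : Code m n C N)

/-- The sample space: the two messages and the two private random variables. -/
abbrev Ω : Type := Fin c.M₁ × Fin c.M₂ × Fin c.K₁ × Fin c.K₂

/-- The probability mass function on the sample space: the messages are uniform, and messages and
private random variables are independent. -/
noncomputable def pmf (ω : c.Ω) : ℝ :=
  (1 / (c.M₁ : ℝ)) * (1 / (c.M₂ : ℝ)) * c.ρ₁ ω.2.2.1 * c.ρ₂ ω.2.2.2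

/-- The message of user 1. -/
def W₁ (ω : c.Ω) : Fin c.M₁ := ω.1

/-- The message of user 2. -/
def W₂ (ω : c.Ω) : Fin c.M₂ := ω.2.1

/-- The signal on the cooperative link. -/
def V (ω : c.Ω) : Fin N → Fin C → ZMod 2 := c.coop ω.2.1 ω.2.2.2

/-- The input block of transmitter 1. -/
def X₁ (ω : c.Ω) : Fin N → Fin m → ZMod 2 := c.enc₁ ω.1 ω.2.2.1 (c.V ω)

/-- The input block of transmitter 2. -/
def X₂ (ω : c.Ω) : Fin N → Fin (max m n) → ZMod 2 := c.enc₂ ω.2.1 ω.2.2.2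

/-- The output block at receiver 1. -/
def Y₁ (ω : c.Ω) : Fin N → Fin (max m n) → ZMod 2 := fun t => output₁ m n (c.X₁ ω t) (c.X₂ ω t)

/-- The output block at receiver 2. -/
def Y₂ (ω : c.Ω) : Fin N → Fin m → ZMod 2 := fun t => output₂ m n (c.X₂ ω t)

/-- The average probability that at least one of the two receivers decodes wrongly. -/
noncomputable def errorProb : ℝ :=
  ∑ ω : c.Ω, if c.dec₁ (c.Y₁ ω) ≠ c.W₁ ω ∨ c.dec₂ (c.Y₂ ω) ≠ c.W₂ ω then c.pmf ω else 0

/-- The information `I(W₁; y₂^N)` about the message of user 1 leaked to receiver 2. -/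
noncomputable def leak₁ : ℝ := mutualInfo c.pmf c.W₁ c.Y₂

/-- The information `I(W₂; y₁^N)` about the message of user 2 leaked to receiver 1. -/
noncomputable def leak₂ : ℝ := mutualInfo c.pmf c.W₂ c.Y₁

end Code

/-! ### Secrecy constraints and capacity regions -/

/-- One code for every block length. -/
abbrev CodeSeq (m n C : ℕ) : Type := (N : ℕ) → Code m n C N

/-- Perfect secrecy: nothing is leaked. -/
def PerfectSecrecy {m n C : ℕ} (c : CodeSeq m n C) : Prop :=
  ∀ N, (c N).leak₁ = 0 ∧ (c N).leak₂ = 0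

/-- Strong secrecy: the leaked information tends to zero. -/
def StrongSecrecy {m n C : ℕ} (c : CodeSeq m n C) : Prop :=
  Filter.Tendsto (fun N => (c N).leak₁) Filter.atTop (nhds 0) ∧
    Filter.Tendsto (fun N => (c N).leak₂) Filter.atTop (nhds 0)

/-- Weak secrecy: the leaked information per channel use tends to zero. -/
def WeakSecrecy {m n C : ℕ} (c : CodeSeq m n C) : Prop :=
  Filter.Tendsto (fun N : ℕ => 1 / (N : ℝ) * (c N).leak₁) Filter.atTop (nhds 0) ∧
    Filter.Tendsto (fun N : ℕ => 1 / (N : ℝ) * (c N).leak₂) Filter.atTop (nhds 0)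

/-- The rate pair `R` is achieved, under the secrecy constraint `S`, by a sequence of codes with at
least `2 ^ (N R₁)` and `2 ^ (N R₂)` messages whose error probability tends to zero. -/
def Achievable {m n C : ℕ} (S : CodeSeq m n C → Prop) (R : ℝ × ℝ) : Prop :=
  0 ≤ R.1 ∧ 0 ≤ R.2 ∧ ∃ c : CodeSeq m n C,
    (∀ N : ℕ, (2 : ℝ) ^ ((N : ℝ) * R.1) ≤ ((c N).M₁ : ℝ) ∧
      (2 : ℝ) ^ ((N : ℝ) * R.2) ≤ ((c N).M₂ : ℝ)) ∧
    Filter.Tendsto (fun N => (c N).errorProb) Filter.atTop (nhds 0) ∧ S c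

/-- The capacity region under the secrecy constraint `S`: the closure of the set of achievable
rate pairs. -/
def capacityRegion {m n C : ℕ} (S : CodeSeq m n C → Prop) : Set (ℝ × ℝ) :=
  closure {R | Achievable S R}

/-- The capacity region under perfect secrecy. -/
def capacityPerfect (m n C : ℕ) : Set (ℝ × ℝ) :=
  capacityRegion (PerfectSecrecy (m := m) (n := n) (C := C))

/-- The capacity region under strong secrecy. -/
def capacityStrong (m n C : ℕ) : Set (ℝ × ℝ) :=
  capacityRegion (StrongSecrecy (m := m) (n := n) (C := C))

/-- The capacity region under weak secrecy. -/
def capacityWeak (m n C : ℕ) : Set (ℝ × ℝ) :=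
  capacityRegion (WeakSecrecy (m := m) (n := n) (C := C))

end ZIC

/-! Both ends of the chain perfect ⊆ strong ⊆ weak are compared with one explicit polygon, `region`:
it contains the weak region and is contained in the perfect one. Leakage of user 1's message is
never an issue, since receiver 2 sees only signals of transmitter 2.

Outer bound. Write G for the data of user 2 and V for the link signal. Giving G to receiver 1 yields
I(W₁;Y₁) ≤ Nm - H(X₁|W₁,G) (`mutualInfo_W₁_Y₁_le`), so jamming by transmitter 1 costs user 1 rate.
Giving Y₁ to receiver 2 yields I(W₂;Y₂) ≤ leak₂ + H(Y₂|Y₁) (`mutualInfo_W₂_Y₂_le`). From Y₁ one gets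
W₁ up to Fano, then V at a cost of NC bits, then X₁ at a cost of H(X₁|V,W₁), and then all of Y₂
except the levels that do not reach receiver 1 (`condEntropy_Y₂_le_of_cooperation`). Since X₁
depends on G only through V once W₁ is given, the two jamming terms cancel in the sum
(`condEntropy_X₁_le`). The leakage enters linearly, so weak secrecy removes it after division by N.

Inner bound. User 2 is silent on the levels that receiver 1 sees in the clear. Transmitter 1 fills
every slot with a message bit or a uniform jamming bit, which is a one-time pad for all
interference, so secrecy is exact at each block length (`slotCode_leak₂`). The link lets transmitter
1 cancel the interference of C levels. Every other interfering slot is given up by one of the two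
users, and any split is allowed (`exists_slots`), so the whole polygon is reached without time
sharing or random coding. -/

namespace ZIC

/-! ### Entropy inequalities on a finite probability space -/

section Entropy

variable {Ω α β γ : Type*} [Fintype Ω] [DecidableEq α] [DecidableEq β] [DecidableEq γ]
variable {p : Ω → ℝ}

theorem prob_nonneg (hp : ∀ ω, 0 ≤ p ω) (X : Ω → α) (x : α) : 0 ≤ prob p X x :=
  Finset.sum_nonneg fun ω _ => by split_ifs <;> simp [hp ω]

theorem le_prob (hp : ∀ ω, 0 ≤ p ω) (X : Ω → α) (ω : Ω) : p ω ≤ prob p X (X ω) := by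
  have h := Finset.single_le_sum (f := fun ω' => if X ω' = X ω then p ω' else 0)
    (fun ω' _ => by split_ifs <;> simp [hp ω']) (Finset.mem_univ ω)
  simpa [prob] using h

/-- Expectation of a function of `X`, computed from the distribution of `X`. -/
theorem sum_prob_mul [Fintype α] (p : Ω → ℝ) (X : Ω → α) (f : α → ℝ) :
    ∑ x, prob p X x * f x = ∑ ω, p ω * f (X ω) := by
  simp only [prob, Finset.sum_mul]
  rw [Finset.sum_comm]
  refine Finset.sum_congr rfl fun ω _ => ?_
  simp [ite_mul]

theorem sum_prob [Fintype α] (p : Ω → ℝ) (X : Ω → α) : ∑ x, prob p X x = ∑ ω, p ω := by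
  simpa using sum_prob_mul p X fun _ => 1

theorem sum_prob_pair_left [Fintype α] (p : Ω → ℝ) (X : Ω → α) (Y : Ω → β) (y : β) :
    ∑ x, prob p (fun ω => (X ω, Y ω)) (x, y) = prob p Y y := by
  simp only [prob]
  rw [Finset.sum_comm]
  refine Finset.sum_congr rfl fun ω _ => ?_
  by_cases h : Y ω = y <;> simp [h]

/-- As an expectation over the sample space, entropies of different variables can be compared point
by point, and points of mass zero drop out. -/
theorem entropy_mul_log [Fintype α] (p : Ω → ℝ) (X : Ω → α) :
    entropy p X * Real.log 2 = -∑ ω, p ω * Real.log (prob p X (X ω)) := by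
  have h2 : Real.log 2 ≠ 0 := (Real.log_pos one_lt_two).ne'
  rw [entropy, div_mul_cancel₀ _ h2, ← sum_prob_mul p X fun x => Real.log (prob p X x),
    ← Finset.sum_neg_distrib]
  exact Finset.sum_congr rfl fun x _ => by rw [Real.negMulLog]; ring

/-- A random variable which is determined by `X` has at most the entropy of `X`. -/
theorem entropy_le_of_determined [Fintype α] [Fintype β] (hp : ∀ ω, 0 ≤ p ω) (X : Ω → α)
    (Y : Ω → β) (h : ∀ ω ω', X ω = X ω' → Y ω = Y ω') : entropy p Y ≤ entropy p X := by
  refine le_of_mul_le_mul_right ?_ (Real.log_pos one_lt_two)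
  rw [entropy_mul_log, entropy_mul_log, neg_le_neg_iff]
  refine Finset.sum_le_sum fun ω _ => ?_
  rcases (hp ω).eq_or_lt with h0 | h0
  · simp [← h0]
  refine mul_le_mul_of_nonneg_left (Real.log_le_log (h0.trans_le (le_prob hp X ω)) ?_) h0.le
  refine Finset.sum_le_sum fun ω' _ => ?_
  by_cases hX : X ω' = X ω
  · simp [hX, h _ _ hX]
  · simp only [hX, if_false]
    split_ifs <;> simp [hp ω']

/-- Gibbs' inequality for a conditional distribution `r` of `X` given `Y`. -/
theorem entropy_pair_le_of_kernel [Fintype α] [Fintype β] (hp : ∀ ω, 0 ≤ p ω)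
    (hp1 : ∑ ω, p ω = 1) (X : Ω → α) (Y : Ω → β) (r : α → β → ℝ) (hr : ∀ x y, 0 ≤ r x y)
    (hr0 : ∀ ω, 0 < p ω → 0 < r (X ω) (Y ω)) (hr1 : ∀ y, ∑ x, r x y ≤ 1) :
    entropy p (fun ω => (X ω, Y ω)) * Real.log 2 ≤
      entropy p Y * Real.log 2 - ∑ ω, p ω * Real.log (r (X ω) (Y ω)) := by
  rw [entropy_mul_log, entropy_mul_log]
  set J : α × β → ℝ := prob p (fun ω => (X ω, Y ω)) with hJ
  have hJ0 : ∀ z, 0 ≤ J z := prob_nonneg hp _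
  -- The expected likelihood ratio of the law P(y) r(x|y) to the true joint law is at most 1; with
  -- log t ≤ t - 1 this is the whole inequality.
  have key : ∑ ω, p ω * (prob p Y (Y ω) * r (X ω) (Y ω) / J (X ω, Y ω)) ≤ 1 := by
    have h1 := sum_prob_mul p (fun ω => (X ω, Y ω))
      fun z : α × β => prob p Y z.2 * r z.1 z.2 / J z
    simp only at h1
    rw [← h1, ← hp1, ← sum_prob p Y]
    calc ∑ z, J z * (prob p Y z.2 * r z.1 z.2 / J z)
        ≤ ∑ z : α × β, prob p Y z.2 * r z.1 z.2 := by
          refine Finset.sum_le_sum fun z _ => ?_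
          rcases (hJ0 z).eq_or_lt with h0 | h0
          · rw [← h0, zero_mul]
            exact mul_nonneg (prob_nonneg hp _ _) (hr _ _)
          · rw [mul_div_cancel₀ _ h0.ne']
      _ = ∑ y, prob p Y y * ∑ x, r x y := by
          rw [Fintype.sum_prod_type_right]
          simp [Finset.mul_sum]
      _ ≤ ∑ y, prob p Y y := Finset.sum_le_sum fun y _ =>
          mul_le_of_le_one_right (prob_nonneg hp _ _) (hr1 y)
  have hlog : ∑ ω, p ω * (Real.log (prob p Y (Y ω)) + Real.log (r (X ω) (Y ω)) -
      Real.log (J (X ω, Y ω))) ≤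
      ∑ ω, p ω * (prob p Y (Y ω) * r (X ω) (Y ω) / J (X ω, Y ω) - 1) := by
    refine Finset.sum_le_sum fun ω _ => ?_
    rcases (hp ω).eq_or_lt with h0 | h0
    · simp [← h0]
    have hY : 0 < prob p Y (Y ω) := h0.trans_le (le_prob hp Y ω)
    have hXY : 0 < J (X ω, Y ω) := h0.trans_le (le_prob hp (fun ω => (X ω, Y ω)) ω)
    refine mul_le_mul_of_nonneg_left ?_ h0.le
    rw [← Real.log_mul hY.ne' (hr0 ω h0).ne',
      ← Real.log_div (mul_pos hY (hr0 ω h0)).ne' hXY.ne']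
    exact Real.log_le_sub_one_of_pos (div_pos (mul_pos hY (hr0 ω h0)) hXY)
  simp only [mul_sub, mul_add, Finset.sum_sub_distrib, Finset.sum_add_distrib, mul_one,
    hp1] at hlog
  linarith

/-- Submodularity of the entropy: conditioning reduces entropy. -/
theorem entropy_submodular [Fintype α] [Fintype β] [Fintype γ] (hp : ∀ ω, 0 ≤ p ω)
    (hp1 : ∑ ω, p ω = 1) (X : Ω → α) (Y : Ω → β) (Z : Ω → γ) :
    entropy p (fun ω => (X ω, Y ω, Z ω)) + entropy p Z ≤
      entropy p (fun ω => (X ω, Z ω)) + entropy p (fun ω => (Y ω, Z ω)) := by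
  have hpos : ∀ ω, 0 < p ω → 0 < prob p Z (Z ω) := fun ω h => h.trans_le (le_prob hp Z ω)
  have hpos' : ∀ ω, 0 < p ω → 0 < prob p (fun ω => (X ω, Z ω)) (X ω, Z ω) :=
    fun ω h => h.trans_le (le_prob hp (fun ω => (X ω, Z ω)) ω)
  -- The kernel is the conditional law of `X` given `Z`, ignoring `Y`. Where `Z` has mass zero the
  -- quotient is 0 by convention, so the kernel sums only to at most 1.
  have h := entropy_pair_le_of_kernel hp hp1 X (fun ω => (Y ω, Z ω))
    (fun x yz => prob p (fun ω => (X ω, Z ω)) (x, yz.2) / prob p Z yz.2)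
    (fun x yz => div_nonneg (prob_nonneg hp _ _) (prob_nonneg hp _ _))
    (fun ω h => div_pos (hpos' ω h) (hpos ω h))
    (fun yz => by
      rw [← Finset.sum_div, sum_prob_pair_left]
      exact div_self_le_one _)
  have hs : ∑ ω, p ω * Real.log (prob p (fun ω => (X ω, Z ω)) (X ω, Z ω) / prob p Z (Z ω)) =
      ∑ ω, p ω * Real.log (prob p (fun ω => (X ω, Z ω)) (X ω, Z ω)) -
        ∑ ω, p ω * Real.log (prob p Z (Z ω)) := by
    rw [← Finset.sum_sub_distrib]
    refine Finset.sum_congr rfl fun ω _ => ?_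
    rcases (hp ω).eq_or_lt with h0 | h0
    · simp [← h0]
    rw [Real.log_div (hpos' ω h0).ne' (hpos ω h0).ne', mul_sub]
  simp only at h
  rw [hs] at h
  have hZ := entropy_mul_log p Z
  have hXZ := entropy_mul_log p fun ω => (X ω, Z ω)
  refine le_of_mul_le_mul_right ?_ (Real.log_pos one_lt_two)
  linarith

/-- Gibbs' inequality with the uniform kernel. -/
theorem entropy_pair_le_add_logb_card [Fintype α] [Fintype β] (hp : ∀ ω, 0 ≤ p ω)
    (hp1 : ∑ ω, p ω = 1) (X : Ω → α) (Y : Ω → β) :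
    entropy p (fun ω => (X ω, Y ω)) ≤ entropy p Y + Real.logb 2 (Fintype.card α) := by
  have hne : Nonempty Ω := by
    by_contra h
    rw [not_nonempty_iff] at h
    simp at hp1
  have hc : 0 < (Fintype.card α : ℝ) := by
    have : Nonempty α := hne.map X
    exact_mod_cast Fintype.card_pos
  have h := entropy_pair_le_of_kernel hp hp1 X Y (fun _ _ => 1 / (Fintype.card α : ℝ))
    (fun _ _ => by positivity) (fun _ _ => by positivity)
    (fun _ => by simp [hc.ne'])
  rw [← Finset.sum_mul, hp1, one_mul, one_div, Real.log_inv] at h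
  have h2 := Real.log_pos one_lt_two
  refine le_of_mul_le_mul_right ?_ h2
  rw [add_mul, Real.logb, div_mul_cancel₀ _ h2.ne']
  linarith

/-- Fano's inequality. -/
theorem fano [Fintype α] [Fintype β] (hp : ∀ ω, 0 ≤ p ω)
    (hp1 : ∑ ω, p ω = 1) (W : Ω → α) (Y : Ω → β) (dec : β → α) :
    entropy p (fun ω => (W ω, Y ω)) ≤ entropy p Y + 1 +
      (∑ ω, if dec (Y ω) ≠ W ω then p ω else 0) * Real.logb 2 (Fintype.card α) := by
  have hne : Nonempty Ω := by
    by_contra h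
    rw [not_nonempty_iff] at h
    simp at hp1
  have hc : 1 ≤ (Fintype.card α : ℝ) := by
    have : Nonempty α := hne.map W
    exact_mod_cast Fintype.card_pos
  have hc0 : 0 < (Fintype.card α : ℝ) := one_pos.trans_le hc
  -- Half the mass sits on the decoded value and half is uniform: one bit is paid always, and log of
  -- the cardinality only on an error. This avoids the binary entropy function.
  set r : α → β → ℝ := fun w y =>
    (if dec y = w then 1 / 2 else 0) + 1 / 2 * (Fintype.card α : ℝ)⁻¹ with hr
  have hrpos : ∀ w y, 0 < r w y := fun w y => by
    have : (0 : ℝ) < 1 / 2 * (Fintype.card α : ℝ)⁻¹ := by positivity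
    simp only [hr]
    split_ifs <;> linarith
  have h := entropy_pair_le_of_kernel hp hp1 W Y r (fun w y => (hrpos w y).le)
    (fun ω _ => hrpos _ _) (fun y => by
      simp [hr, Finset.sum_add_distrib]
      field_simp
      norm_num)
  have hlogc : 0 ≤ Real.log (Fintype.card α) := Real.log_nonneg hc
  have hb : ∑ ω, p ω * -Real.log (r (W ω) (Y ω)) ≤
      ∑ ω, (p ω * Real.log 2 +
        (if dec (Y ω) ≠ W ω then p ω else 0) * Real.log (Fintype.card α)) := by
    refine Finset.sum_le_sum fun ω _ => ?_
    by_cases hd : dec (Y ω) = W ω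
    · simp only [hd, ne_eq, not_true_eq_false, if_false, zero_mul, add_zero]
      refine mul_le_mul_of_nonneg_left ?_ (hp ω)
      rw [← Real.log_inv]
      refine Real.log_le_log (inv_pos.2 (hrpos _ _)) ?_
      rw [inv_le_comm₀ (hrpos _ _) two_pos]
      simp only [hr, hd, if_true]
      have : (0 : ℝ) < 1 / 2 * (Fintype.card α : ℝ)⁻¹ := by positivity
      linarith
    · simp only [hd, ne_eq, not_false_eq_true, if_true]
      rw [← mul_add]
      refine mul_le_mul_of_nonneg_left (le_of_eq ?_) (hp ω)
      simp only [hr, hd, if_false, zero_add]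
      rw [Real.log_mul (by norm_num) (inv_pos.2 hc0).ne', Real.log_inv, one_div, Real.log_inv]
      ring
  rw [Finset.sum_add_distrib, ← Finset.sum_mul, ← Finset.sum_mul, hp1] at hb
  simp only [mul_neg, Finset.sum_neg_distrib] at hb
  have h2 := Real.log_pos one_lt_two
  refine le_of_mul_le_mul_right ?_ h2
  rw [add_mul, add_mul, mul_assoc, Real.logb, div_mul_cancel₀ _ h2.ne']
  linarith

theorem entropy_pair_eq_add_of_prob [Fintype α] [Fintype β] (hp : ∀ ω, 0 ≤ p ω)
    (X : Ω → α) (Y : Ω → β)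
    (h : ∀ x y, prob p (fun ω => (X ω, Y ω)) (x, y) = prob p X x * prob p Y y) :
    entropy p (fun ω => (X ω, Y ω)) = entropy p X + entropy p Y := by
  refine mul_right_cancel₀ (Real.log_pos one_lt_two).ne' ?_
  rw [add_mul, entropy_mul_log, entropy_mul_log, entropy_mul_log, ← neg_add,
    ← Finset.sum_add_distrib]
  congr 1
  refine Finset.sum_congr rfl fun ω _ => ?_
  rcases (hp ω).eq_or_lt with h0 | h0
  · simp [← h0]
  rw [h, Real.log_mul (h0.trans_le (le_prob hp X ω)).ne' (h0.trans_le (le_prob hp Y ω)).ne',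
    mul_add]

/-- Functions of the two components of a product distribution have additive entropies. -/
theorem entropy_pair_eq_add [Fintype α] [Fintype β] {A B : Type*} [Fintype A] [Fintype B]
    (e : Ω ≃ A × B) {p₁ : A → ℝ} {p₂ : B → ℝ} (hp : ∀ ω, 0 ≤ p ω)
    (h₁ : ∑ a, p₁ a = 1) (h₂ : ∑ b, p₂ b = 1) (he : ∀ ω, p ω = p₁ (e ω).1 * p₂ (e ω).2)
    (f : A → α) (g : B → β) (X : Ω → α) (Y : Ω → β) (hX : ∀ ω, X ω = f (e ω).1)
    (hY : ∀ ω, Y ω = g (e ω).2) :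
    entropy p (fun ω => (X ω, Y ω)) = entropy p X + entropy p Y := by
  refine entropy_pair_eq_add_of_prob hp X Y fun x y => ?_
  have h12 : ∀ (F : A → ℝ) (G : B → ℝ), ∑ ω, F (e ω).1 * G (e ω).2 = (∑ a, F a) * ∑ b, G b := by
    intro F G
    rw [Equiv.sum_comp e fun z : A × B => F z.1 * G z.2, Fintype.sum_prod_type,
      Finset.sum_mul_sum]
  have hx : prob p X x = ∑ a, if f a = x then p₁ a else 0 := by
    have := h12 (fun a => if f a = x then p₁ a else 0) p₂
    rw [h₂, mul_one] at this
    rw [← this]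
    exact Finset.sum_congr rfl fun ω _ => by simp [hX, he, ite_mul]
  have hy : prob p Y y = ∑ b, if g b = y then p₂ b else 0 := by
    have := h12 p₁ (fun b => if g b = y then p₂ b else 0)
    rw [h₁, one_mul] at this
    rw [← this]
    exact Finset.sum_congr rfl fun ω _ => by simp [hY, he, mul_ite]
  rw [hx, hy, ← h12]
  refine Finset.sum_congr rfl fun ω _ => ?_
  simp only [hX, hY, he, Prod.mk.injEq]
  by_cases h1 : f (e ω).1 = x <;> by_cases h2 : g (e ω).2 = y <;> simp [h1, h2]

theorem entropy_eq_logb_card [Fintype α] (X : Ω → α)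
    (h : ∀ x, prob p X x = 1 / (Fintype.card α : ℝ)) :
    entropy p X = Real.logb 2 (Fintype.card α) := by
  rcases isEmpty_or_nonempty α with hα | hα
  · simp [entropy]
  have hc : (Fintype.card α : ℝ) ≠ 0 := by exact_mod_cast Fintype.card_ne_zero
  simp only [entropy, h, Finset.sum_const, Finset.card_univ, nsmul_eq_mul, Real.negMulLog,
    one_div, Real.log_inv, Real.logb]
  field_simp

end Entropy


/-! ### The channel in coordinates -/

theorem downshift_mulVec {q : ℕ} (x : Fin q → ZMod 2) (i : Fin q) :
    (downshift q).mulVec x i =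
      if _h : 1 ≤ (i : ℕ) then x ⟨i - 1, (Nat.sub_le _ _).trans_lt i.isLt⟩ else 0 := by
  simp only [Matrix.mulVec, dotProduct, downshift, Matrix.of_apply, ite_mul, one_mul, zero_mul]
  split_ifs with h
  · rw [Finset.sum_eq_single ⟨i - 1, (Nat.sub_le _ _).trans_lt i.isLt⟩]
    · rw [if_pos (by simp; omega)]
    · intro j _ hj
      rw [if_neg]
      intro h'
      exact hj (Fin.ext (by simp; omega))
    · simp
  · exact Finset.sum_eq_zero fun j _ => if_neg (by omega)

theorem downshift_pow_mulVec {q : ℕ} (k : ℕ) (x : Fin q → ZMod 2) (i : Fin q) :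
    (downshift q ^ k).mulVec x i =
      if _h : k ≤ (i : ℕ) then x ⟨i - k, (Nat.sub_le _ _).trans_lt i.isLt⟩ else 0 := by
  induction k generalizing i with
  | zero => simp
  | succ k ih =>
    rw [pow_succ', ← Matrix.mulVec_mulVec, downshift_mulVec]
    by_cases h1 : 1 ≤ (i : ℕ)
    · rw [dif_pos h1, ih]
      by_cases h2 : k + 1 ≤ (i : ℕ)
      · rw [dif_pos h2, dif_pos (by simp; omega)]
        congr 1
        exact Fin.ext (by simp; omega)
      · rw [dif_neg h2, dif_neg (by simp; omega)]
    · rw [dif_neg h1, dif_neg (by omega)]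

theorem output₁_apply {m n : ℕ} (x₁ : Fin m → ZMod 2) (x₂ : Fin (max m n) → ZMod 2)
    (j : Fin (max m n)) :
    output₁ m n x₁ x₂ j =
      (if _h : max m n - m ≤ (j : ℕ) then x₁ ⟨j - (max m n - m), by omega⟩ else 0) +
      (if _h : max m n - n ≤ (j : ℕ) then
        x₂ ⟨j - (max m n - n), (Nat.sub_le _ _).trans_lt j.isLt⟩ else 0) := by
  rw [output₁, Pi.add_apply, downshift_pow_mulVec, downshift_pow_mulVec]
  congr 1
  split_ifs with h
  · rw [pad, dif_pos]
  · rfl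

theorem output₂_apply {m n : ℕ} (x₂ : Fin (max m n) → ZMod 2) (i : Fin m) :
    output₂ m n x₂ i = x₂ ⟨i, i.isLt.trans_le (le_max_left m n)⟩ := by
  rw [output₂, downshift_pow_mulVec, dif_pos (by simp)]
  congr 1
  exact Fin.ext (by simp)

/-- The input of transmitter 1 is determined by the output at receiver 1 and the other input. -/
theorem input₁_eq {m n : ℕ} (x₁ : Fin m → ZMod 2) (x₂ : Fin (max m n) → ZMod 2) (i : Fin m) :
    x₁ i = output₁ m n x₁ x₂ ⟨i + (max m n - m), by omega⟩ -
      output₁ m n 0 x₂ ⟨i + (max m n - m), by omega⟩ := by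
  rw [output₁_apply, output₁_apply]
  simp

/-- The output at receiver 2 on the levels below `n`. -/
theorem output₂_eq_of_lt {m n : ℕ} (x₁ : Fin m → ZMod 2) (x₂ : Fin (max m n) → ZMod 2) (i : Fin m)
    (hi : (i : ℕ) < n) :
    output₂ m n x₂ i = output₁ m n x₁ x₂ ⟨i + (max m n - n), by omega⟩ -
      output₁ m n x₁ 0 ⟨i + (max m n - n), by omega⟩ := by
  rw [output₂_apply, output₁_apply, output₁_apply]
  simp

/-- The output at receiver 2 on the levels which receiver 1 sees without interference. -/
theorem output₂_eq_of_lt_sub {m n : ℕ} (x₁ : Fin m → ZMod 2) (x₂ : Fin (max m n) → ZMod 2)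
    (i : Fin m) (hi : (i : ℕ) < n - m) :
    output₂ m n x₂ i = output₁ m n x₁ x₂ ⟨i, by omega⟩ := by
  rw [output₂_apply, output₁_apply, dif_neg (by simp; omega), dif_pos (by simp; omega), zero_add]
  congr 1
  exact Fin.ext (by simp; omega)

theorem logb_card_block (N k : ℕ) :
    Real.logb 2 (Fintype.card (Fin N → Fin k → ZMod 2)) = N * k := by
  have : Fintype.card (Fin N → Fin k → ZMod 2) = 2 ^ (N * k) := by
    simp [← pow_mul, mul_comm]
  rw [this]
  push_cast
  rw [Real.logb_pow]
  simp

/-! ### Independence and uniformity of the messages and the private randomness -/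

namespace Code

variable {m n C N : ℕ} (c : Code m n C N)

/-- The message and the private randomness of user 2. -/
def G (ω : c.Ω) : Fin c.M₂ × Fin c.K₂ := (ω.2.1, ω.2.2.2)

/-- The private randomness of transmitter 1. -/
def R₁ (ω : c.Ω) : Fin c.K₁ := ω.2.2.1

theorem pmf_nonneg (ω : c.Ω) : 0 ≤ c.pmf ω := by
  have h1 := c.ρ₁_mem.1 ω.2.2.1
  have h2 := c.ρ₂_mem.1 ω.2.2.2
  unfold pmf
  positivity

theorem sum_uniform₁ : ∑ _a : Fin c.M₁, (1 / (c.M₁ : ℝ)) = 1 := by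
  have : (c.M₁ : ℝ) ≠ 0 := by exact_mod_cast c.M₁_pos.ne'
  simp [this]

theorem sum_uniform₂ : ∑ _a : Fin c.M₂, (1 / (c.M₂ : ℝ)) = 1 := by
  have : (c.M₂ : ℝ) ≠ 0 := by exact_mod_cast c.M₂_pos.ne'
  simp [this]

theorem sum_prod_eq_one {A B : Type*} [Fintype A] [Fintype B] {f : A → ℝ} {g : B → ℝ}
    (hf : ∑ a, f a = 1) (hg : ∑ b, g b = 1) : ∑ z : A × B, f z.1 * g z.2 = 1 := by
  rw [Fintype.sum_prod_type, ← Finset.sum_mul_sum, hf, hg, one_mul]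

/-- The law of the data of user 1. -/
theorem sum_user₁ : ∑ z : Fin c.M₁ × Fin c.K₁, 1 / (c.M₁ : ℝ) * c.ρ₁ z.2 = 1 :=
  sum_prod_eq_one c.sum_uniform₁ c.ρ₁_mem.2

theorem sum_user₂ : ∑ z : Fin c.M₂ × Fin c.K₂, 1 / (c.M₂ : ℝ) * c.ρ₂ z.2 = 1 :=
  sum_prod_eq_one c.sum_uniform₂ c.ρ₂_mem.2

/-- The sample space as the product of the data of the two users. -/
def usersEquiv : c.Ω ≃ (Fin c.M₁ × Fin c.K₁) × (Fin c.M₂ × Fin c.K₂) where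
  toFun ω := ((ω.1, ω.2.2.1), (ω.2.1, ω.2.2.2))
  invFun z := (z.1.1, z.2.1, z.1.2, z.2.2)
  left_inv _ := rfl
  right_inv _ := rfl

/-- The sample space with the private randomness of transmitter 1 split off. -/
def randomnessEquiv : c.Ω ≃ Fin c.K₁ × (Fin c.M₁ × (Fin c.M₂ × Fin c.K₂)) where
  toFun ω := (ω.2.2.1, ω.1, ω.2.1, ω.2.2.2)
  invFun z := (z.2.1, z.2.2.1, z.1, z.2.2.2)
  left_inv _ := rfl
  right_inv _ := rfl

theorem sum_users (F : Fin c.M₁ × Fin c.K₁ → ℝ) (G : Fin c.M₂ × Fin c.K₂ → ℝ) :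
    ∑ ω : c.Ω, F (ω.1, ω.2.2.1) * G (ω.2.1, ω.2.2.2) = (∑ z, F z) * ∑ z, G z := by
  rw [Finset.sum_mul_sum, ← Fintype.sum_prod_type', ← Equiv.sum_comp c.usersEquiv]
  rfl

theorem pmf_eq_mul (ω : c.Ω) : c.pmf ω =
    (1 / (c.M₁ : ℝ) * c.ρ₁ ω.2.2.1) * (1 / (c.M₂ : ℝ) * c.ρ₂ ω.2.2.2) := by
  rw [pmf]
  ring

theorem sum_pmf : ∑ ω, c.pmf ω = 1 := by
  have h := c.sum_users (fun z => 1 / (c.M₁ : ℝ) * c.ρ₁ z.2) (fun z => 1 / (c.M₂ : ℝ) * c.ρ₂ z.2)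
  rw [c.sum_user₁, c.sum_user₂, one_mul] at h
  rw [← h]
  exact Finset.sum_congr rfl fun ω _ => c.pmf_eq_mul ω

theorem entropy_users {α β : Type*} [Fintype α] [Fintype β] [DecidableEq α] [DecidableEq β]
    (f : Fin c.M₁ × Fin c.K₁ → α) (g : Fin c.M₂ × Fin c.K₂ → β) :
    entropy c.pmf (fun ω => (f (ω.1, ω.2.2.1), g (ω.2.1, ω.2.2.2))) =
      entropy c.pmf (fun ω => f (ω.1, ω.2.2.1)) +
        entropy c.pmf (fun ω => g (ω.2.1, ω.2.2.2)) :=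
  entropy_pair_eq_add c.usersEquiv c.pmf_nonneg c.sum_user₁ c.sum_user₂
    (fun ω => by simp only [pmf, usersEquiv, Equiv.coe_fn_mk]; ring) f g _ _
    (fun _ => rfl) (fun _ => rfl)

/-- This independence is the source of the Markov chain from the data of user 2 through the link
signal to `X₁`, given `W₁`. -/
theorem entropy_R₁_pair {α : Type*} [Fintype α] [DecidableEq α]
    (g : Fin c.M₁ × (Fin c.M₂ × Fin c.K₂) → α) :
    entropy c.pmf (fun ω => (c.R₁ ω, g (ω.1, ω.2.1, ω.2.2.2))) =
      entropy c.pmf c.R₁ + entropy c.pmf (fun ω => g (ω.1, ω.2.1, ω.2.2.2)) :=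
  entropy_pair_eq_add c.randomnessEquiv c.pmf_nonneg c.ρ₁_mem.2
    (sum_prod_eq_one c.sum_uniform₁ c.sum_user₂)
    (fun ω => by simp only [pmf, randomnessEquiv, Equiv.coe_fn_mk]; ring) id g _ _
    (fun _ => rfl) (fun _ => rfl)

theorem sum_ite_fst_eq {A B : Type*} [Fintype A] [Fintype B] [DecidableEq A] (f : A × B → ℝ)
    (a : A) : ∑ z : A × B, (if z.1 = a then f z else 0) = ∑ b, f (a, b) := by
  rw [Fintype.sum_prod_type, Finset.sum_eq_single a (fun b _ hb => by simp [hb]) (by simp)]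
  simp

theorem prob_W₁ (a : Fin c.M₁) : prob c.pmf c.W₁ a = 1 / (c.M₁ : ℝ) := by
  have h := c.sum_users (fun z => if z.1 = a then 1 / (c.M₁ : ℝ) * c.ρ₁ z.2 else 0)
    (fun z => 1 / (c.M₂ : ℝ) * c.ρ₂ z.2)
  rw [c.sum_user₂, mul_one, sum_ite_fst_eq, ← Finset.mul_sum, c.ρ₁_mem.2, mul_one] at h
  rw [← h]
  exact Finset.sum_congr rfl fun ω _ => by simp only [W₁, pmf_eq_mul, ite_mul, zero_mul]

theorem prob_W₂ (a : Fin c.M₂) : prob c.pmf c.W₂ a = 1 / (c.M₂ : ℝ) := by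
  have h := c.sum_users (fun z => 1 / (c.M₁ : ℝ) * c.ρ₁ z.2)
    (fun z => if z.1 = a then 1 / (c.M₂ : ℝ) * c.ρ₂ z.2 else 0)
  rw [c.sum_user₁, one_mul, sum_ite_fst_eq, ← Finset.mul_sum, c.ρ₂_mem.2, mul_one] at h
  rw [← h]
  exact Finset.sum_congr rfl fun ω _ => by simp only [W₂, pmf_eq_mul, mul_ite, mul_zero]

theorem entropy_W₁ : entropy c.pmf c.W₁ = Real.logb 2 c.M₁ := by
  simpa using entropy_eq_logb_card c.W₁ fun a => by simpa using c.prob_W₁ a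

theorem entropy_W₂ : entropy c.pmf c.W₂ = Real.logb 2 c.M₂ := by
  simpa using entropy_eq_logb_card c.W₂ fun a => by simpa using c.prob_W₂ a

/-! ### The converse -/

theorem logb_M₁_nonneg : 0 ≤ Real.logb 2 (c.M₁ : ℝ) :=
  Real.logb_nonneg one_lt_two (by exact_mod_cast c.M₁_pos)

theorem logb_M₂_nonneg : 0 ≤ Real.logb 2 (c.M₂ : ℝ) :=
  Real.logb_nonneg one_lt_two (by exact_mod_cast c.M₂_pos)

/-- The error event of a single receiver is contained in the joint one. -/
theorem fano₁ : entropy c.pmf (fun ω => (c.W₁ ω, c.Y₁ ω)) ≤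
    entropy c.pmf c.Y₁ + 1 + c.errorProb * Real.logb 2 c.M₁ := by
  have h := fano c.pmf_nonneg c.sum_pmf c.W₁ c.Y₁ c.dec₁
  rw [Fintype.card_fin] at h
  refine h.trans (add_le_add le_rfl (mul_le_mul_of_nonneg_right ?_ c.logb_M₁_nonneg))
  refine Finset.sum_le_sum fun ω _ => ?_
  have := c.pmf_nonneg ω
  by_cases h1 : c.dec₁ (c.Y₁ ω) = c.W₁ ω <;> simp [h1]
  split_ifs <;> simp [this]

theorem fano₂ : entropy c.pmf (fun ω => (c.W₂ ω, c.Y₂ ω)) ≤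
    entropy c.pmf c.Y₂ + 1 + c.errorProb * Real.logb 2 c.M₂ := by
  have h := fano c.pmf_nonneg c.sum_pmf c.W₂ c.Y₂ c.dec₂
  rw [Fintype.card_fin] at h
  refine h.trans (add_le_add le_rfl (mul_le_mul_of_nonneg_right ?_ c.logb_M₂_nonneg))
  refine Finset.sum_le_sum fun ω _ => ?_
  have := c.pmf_nonneg ω
  by_cases h1 : c.dec₂ (c.Y₂ ω) = c.W₂ ω <;> simp [h1]
  split_ifs <;> simp [this]

theorem V_eq_of_G {ω ω' : c.Ω} (h : c.G ω = c.G ω') : c.V ω = c.V ω' := by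
  simp only [G, Prod.mk.injEq] at h
  simp [V, h.1, h.2]

theorem X₂_eq_of_G {ω ω' : c.Ω} (h : c.G ω = c.G ω') : c.X₂ ω = c.X₂ ω' := by
  simp only [G, Prod.mk.injEq] at h
  simp [X₂, h.1, h.2]

theorem X₁_eq_of_Y₁ {ω ω' : c.Ω} (hY : c.Y₁ ω = c.Y₁ ω') (hX : c.X₂ ω = c.X₂ ω') :
    c.X₁ ω = c.X₁ ω' := by
  funext t i
  have h1 : output₁ m n (c.X₁ ω t) (c.X₂ ω t) = output₁ m n (c.X₁ ω' t) (c.X₂ ω' t) :=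
    congrFun hY t
  rw [input₁_eq (c.X₁ ω t) (c.X₂ ω t), h1, hX, ← input₁_eq]

/-- As `W₁` is independent of `G`, handing `G` to receiver 1 gives I(W₁;Y₁) ≤ I(W₁;Y₁|G). Given `G`,
the output and `X₁` determine each other, and H(X₁|G) is at most Nm bits. -/
theorem mutualInfo_W₁_Y₁_le : mutualInfo c.pmf c.W₁ c.Y₁ ≤ N * m +
    entropy c.pmf (fun ω => (c.W₁ ω, c.G ω)) -
      entropy c.pmf (fun ω => (c.X₁ ω, c.W₁ ω, c.G ω)) := by
  have hp := c.pmf_nonneg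
  have h1 := entropy_submodular hp c.sum_pmf c.W₁ c.G c.Y₁
  have h2 : entropy c.pmf (fun ω => (c.X₁ ω, c.W₁ ω, c.G ω)) ≤
      entropy c.pmf (fun ω => (c.W₁ ω, c.G ω, c.Y₁ ω)) :=
    entropy_le_of_determined hp _ _ fun ω ω' h => by
      simp only [Prod.mk.injEq] at h ⊢
      exact ⟨c.X₁_eq_of_Y₁ h.2.2 (c.X₂_eq_of_G h.2.1), h.1, h.2.1⟩
  have h3 : entropy c.pmf (fun ω => (c.G ω, c.Y₁ ω)) ≤
      entropy c.pmf (fun ω => (c.X₁ ω, c.G ω)) :=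
    entropy_le_of_determined hp _ _ fun ω ω' h => by
      simp only [Prod.mk.injEq] at h ⊢
      refine ⟨h.2, ?_⟩
      funext t
      simp only [Y₁, h.1, c.X₂_eq_of_G h.2]
  have h4 := entropy_pair_le_add_logb_card hp c.sum_pmf c.X₁ c.G
  rw [logb_card_block] at h4
  have h5 : entropy c.pmf (fun ω => (c.W₁ ω, c.G ω)) =
      entropy c.pmf c.W₁ + entropy c.pmf c.G := c.entropy_users Prod.fst id
  unfold mutualInfo
  linarith

-- In conditional form, H(X₁|V,W₁) ≤ H(X₁|W₁,G). Given `V` and `W₁`, only `R₁` still varies in `X₁`,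
-- and it is independent of `G`; submodularity is applied to `R₁` and `G` over (X₁,V,W₁).
set_option synthInstance.maxSize 1024 in
theorem condEntropy_X₁_le :
    entropy c.pmf (fun ω => (c.X₁ ω, c.V ω, c.W₁ ω)) +
        entropy c.pmf (fun ω => (c.W₁ ω, c.G ω)) ≤
      entropy c.pmf (fun ω => (c.X₁ ω, c.W₁ ω, c.G ω)) +
        entropy c.pmf (fun ω => (c.V ω, c.W₁ ω)) := by
  have hp := c.pmf_nonneg
  have hX : ∀ ω ω' : c.Ω, c.R₁ ω = c.R₁ ω' → c.V ω = c.V ω' → c.W₁ ω = c.W₁ ω' →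
      c.X₁ ω = c.X₁ ω' := fun ω ω' h1 h2 h3 => by
    simp only [R₁, W₁] at h1 h3
    simp only [X₁, h1, h2, h3]
  have h1 := entropy_submodular hp c.sum_pmf c.R₁ c.G (fun ω => (c.X₁ ω, c.V ω, c.W₁ ω))
  have h2 : entropy c.pmf (fun ω => (c.R₁ ω, c.X₁ ω, c.V ω, c.W₁ ω)) ≤
      entropy c.pmf (fun ω => (c.R₁ ω, c.V ω, c.W₁ ω)) :=
    entropy_le_of_determined hp _ _ fun ω ω' h => by
      simp only [Prod.mk.injEq] at h ⊢
      exact ⟨h.1, hX _ _ h.1 h.2.1 h.2.2, h.2⟩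
  have h3 : entropy c.pmf (fun ω => (c.R₁ ω, c.V ω, c.W₁ ω)) =
      entropy c.pmf c.R₁ + entropy c.pmf (fun ω => (c.V ω, c.W₁ ω)) :=
    c.entropy_R₁_pair fun z => (c.coop z.2.1 z.2.2, z.1)
  have h4 : entropy c.pmf (fun ω => (c.R₁ ω, c.W₁ ω, c.G ω)) =
      entropy c.pmf c.R₁ + entropy c.pmf (fun ω => (c.W₁ ω, c.G ω)) :=
    c.entropy_R₁_pair id
  have h5 : entropy c.pmf (fun ω => (c.R₁ ω, c.W₁ ω, c.G ω)) ≤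
      entropy c.pmf (fun ω => (c.R₁ ω, c.G ω, c.X₁ ω, c.V ω, c.W₁ ω)) :=
    entropy_le_of_determined hp _ _ fun ω ω' h => by
      simp only [Prod.mk.injEq] at h ⊢
      exact ⟨h.1, h.2.2.2.2, h.2.1⟩
  have h6 : entropy c.pmf (fun ω => (c.G ω, c.X₁ ω, c.V ω, c.W₁ ω)) ≤
      entropy c.pmf (fun ω => (c.X₁ ω, c.W₁ ω, c.G ω)) :=
    entropy_le_of_determined hp _ _ fun ω ω' h => by
      simp only [Prod.mk.injEq] at h ⊢
      exact ⟨h.2.2, h.1, c.V_eq_of_G h.2.2, h.2.1⟩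
  linarith

theorem condEntropy_X₁_nonneg : entropy c.pmf (fun ω => (c.W₁ ω, c.G ω)) ≤
    entropy c.pmf (fun ω => (c.X₁ ω, c.W₁ ω, c.G ω)) :=
  entropy_le_of_determined c.pmf_nonneg _ _ fun ω ω' h => by
    simp only [Prod.mk.injEq] at h ⊢
    exact h.2

/-- I(W₂;Y₂) ≤ I(W₂;Y₁) + I(W₂;Y₂|Y₁), and the last term is at most H(Y₂|Y₁). This is where secrecy
enters the converse. -/
theorem mutualInfo_W₂_Y₂_le : mutualInfo c.pmf c.W₂ c.Y₂ ≤
    c.leak₂ + entropy c.pmf (fun ω => (c.Y₁ ω, c.Y₂ ω)) - entropy c.pmf c.Y₁ := by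
  have h1 := entropy_submodular c.pmf_nonneg c.sum_pmf c.W₂ c.Y₁ c.Y₂
  have h2 : entropy c.pmf (fun ω => (c.W₂ ω, c.Y₁ ω)) ≤
      entropy c.pmf (fun ω => (c.W₂ ω, c.Y₁ ω, c.Y₂ ω)) :=
    entropy_le_of_determined c.pmf_nonneg _ _ fun ω ω' h => by
      simp only [Prod.mk.injEq] at h ⊢
      exact ⟨h.1, h.2.1⟩
  unfold leak₂ mutualInfo
  linarith

/-- The top n - m levels of x₂ reach receiver 1 above the levels of x₁, so only the remaining ones
are uncertain given `Y₁`. -/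
theorem condEntropy_Y₂_le_of_interference :
    entropy c.pmf (fun ω => (c.Y₁ ω, c.Y₂ ω)) ≤ entropy c.pmf c.Y₁ + N * (m - (n - m) : ℕ) := by
  set B : c.Ω → Fin N → Fin (m - (n - m)) → ZMod 2 :=
    fun ω t i => c.Y₂ ω t ⟨n - m + i, by omega⟩ with hB
  have h1 := entropy_pair_le_add_logb_card c.pmf_nonneg c.sum_pmf B c.Y₁
  rw [logb_card_block] at h1
  refine le_trans (entropy_le_of_determined c.pmf_nonneg _ _ fun ω ω' h => ?_) h1
  simp only [Prod.mk.injEq] at h ⊢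
  refine ⟨h.2, ?_⟩
  funext t i
  by_cases hi : (i : ℕ) < n - m
  · have h2 : output₁ m n (c.X₁ ω t) (c.X₂ ω t) = output₁ m n (c.X₁ ω' t) (c.X₂ ω' t) :=
      congrFun h.2 t
    rw [Y₂, output₂_eq_of_lt_sub (c.X₁ ω t) _ i hi, h2, ← output₂_eq_of_lt_sub _ _ i hi, Y₂]
  · have h2 := congrFun (congrFun h.1 t) ⟨i - (n - m), by omega⟩
    simp only [hB] at h2
    have h3 : n - m + ((i : ℕ) - (n - m)) = i := by omega
    simpa only [h3, Fin.eta] using h2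

-- Starting from (W₁,Y₁), reveal `V`, then `X₁`, then the m - n levels of `Y₂` below the reach of
-- the cross link. Subtracting `X₁` from `Y₁` exposes the other levels of `Y₂`.
set_option synthInstance.maxSize 1024 in
theorem condEntropy_Y₂_le_of_cooperation :
    entropy c.pmf (fun ω => (c.Y₁ ω, c.Y₂ ω)) + entropy c.pmf (fun ω => (c.V ω, c.W₁ ω)) ≤
      entropy c.pmf (fun ω => (c.W₁ ω, c.Y₁ ω)) + N * C + N * (m - n : ℕ) +
        entropy c.pmf (fun ω => (c.X₁ ω, c.V ω, c.W₁ ω)) := by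
  have hp := c.pmf_nonneg
  set B : c.Ω → Fin N → Fin (m - n) → ZMod 2 :=
    fun ω t i => c.Y₂ ω t ⟨n + i, by omega⟩ with hB
  have h1 := entropy_pair_le_add_logb_card hp c.sum_pmf B
    (fun ω => (c.X₁ ω, c.Y₁ ω, c.V ω, c.W₁ ω))
  have h2 := entropy_submodular hp c.sum_pmf c.X₁ c.Y₁ (fun ω => (c.V ω, c.W₁ ω))
  have h3 := entropy_pair_le_add_logb_card hp c.sum_pmf c.V (fun ω => (c.W₁ ω, c.Y₁ ω))
  rw [logb_card_block] at h1 h3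
  have h4 : entropy c.pmf (fun ω => (c.Y₁ ω, c.V ω, c.W₁ ω)) ≤
      entropy c.pmf (fun ω => (c.V ω, c.W₁ ω, c.Y₁ ω)) :=
    entropy_le_of_determined hp _ _ fun ω ω' h => by
      simp only [Prod.mk.injEq] at h ⊢
      exact ⟨h.2.2, h.1, h.2.1⟩
  have h5 : entropy c.pmf (fun ω => (c.Y₁ ω, c.Y₂ ω)) ≤
      entropy c.pmf (fun ω => (B ω, c.X₁ ω, c.Y₁ ω, c.V ω, c.W₁ ω)) := by
    refine entropy_le_of_determined hp _ _ fun ω ω' h => ?_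
    simp only [Prod.mk.injEq] at h ⊢
    refine ⟨h.2.2.1, ?_⟩
    funext t i
    by_cases hi : (i : ℕ) < n
    · have h2 : output₁ m n (c.X₁ ω t) (c.X₂ ω t) = output₁ m n (c.X₁ ω' t) (c.X₂ ω' t) :=
        congrFun h.2.2.1 t
      rw [Y₂, output₂_eq_of_lt (c.X₁ ω t) _ i hi, h2, h.2.1, ← output₂_eq_of_lt _ _ i hi, Y₂]
    · have h2 := congrFun (congrFun h.1 t) ⟨i - n, by omega⟩
      simp only [hB] at h2
      have h3 : n + ((i : ℕ) - n) = i := by omega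
      simpa only [h3, Fin.eta] using h2
  linarith

theorem rate₁_bound : (1 - c.errorProb) * Real.logb 2 c.M₁ ≤ N * m + 1 := by
  have h1 := c.mutualInfo_W₁_Y₁_le
  have h2 := c.condEntropy_X₁_nonneg
  have h3 := c.fano₁
  rw [mutualInfo, c.entropy_W₁] at h1
  linarith

theorem rate₂_bound :
    (1 - c.errorProb) * Real.logb 2 c.M₂ ≤ N * (m - (n - m) : ℕ) + c.leak₂ + 1 := by
  have h1 := c.mutualInfo_W₂_Y₂_le
  have h2 := c.condEntropy_Y₂_le_of_interference
  have h3 := c.fano₂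
  rw [mutualInfo, c.entropy_W₂] at h1
  linarith

/-- The terms H(X₁|W₁,G) and H(X₁|V,W₁) cancel. Fano for receiver 1 is used twice, once for its rate
and once to pass from `Y₁` to (W₁,Y₁), whence the factor 2 and the constant 3. -/
theorem sum_rate_bound :
    (1 - 2 * c.errorProb) * Real.logb 2 c.M₁ + (1 - c.errorProb) * Real.logb 2 c.M₂ ≤
      N * (m + (m - n : ℕ) + C) + c.leak₂ + 3 := by
  have h1 := c.mutualInfo_W₁_Y₁_le
  have h2 := c.mutualInfo_W₂_Y₂_le
  have h3 := c.fano₁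
  have h4 := c.fano₂
  have h5 := c.condEntropy_Y₂_le_of_cooperation
  have h6 := c.condEntropy_X₁_le
  rw [mutualInfo, c.entropy_W₁] at h1
  rw [mutualInfo, c.entropy_W₂] at h2
  linarith

end Code

/-- The capacity region of the Z-interference channel under each of the secrecy constraints. -/
def region (m n C : ℕ) : Set (ℝ × ℝ) :=
  {R | 0 ≤ R.1 ∧ 0 ≤ R.2 ∧ R.1 ≤ m ∧ R.2 ≤ (m - (n - m) : ℕ) ∧
    R.1 + R.2 ≤ m + (m - n : ℕ) + C}

theorem isClosed_region (m n C : ℕ) : IsClosed (region m n C) := by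
  unfold region
  simp only [Set.ofPred_and]
  exact (isClosed_le continuous_const continuous_fst).inter <|
    (isClosed_le continuous_const continuous_snd).inter <|
    (isClosed_le continuous_fst continuous_const).inter <|
    (isClosed_le continuous_snd continuous_const).inter <|
    isClosed_le (continuous_fst.add continuous_snd) continuous_const

open Filter Topology in
theorem mem_region_of_achievable_weak {m n C : ℕ} {R : ℝ × ℝ}
    (hR : Achievable (WeakSecrecy (m := m) (n := n) (C := C)) R) : R ∈ region m n C := by
  obtain ⟨hR1, hR2, c, hM, herr, -, hleak⟩ := hR
  have hinv : Tendsto (fun N : ℕ => 1 / (N : ℝ)) atTop (𝓝 0) :=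
    tendsto_const_div_atTop_nhds_zero_nat 1
  have hlog : ∀ N : ℕ, N * R.1 ≤ Real.logb 2 (c N).M₁ ∧ N * R.2 ≤ Real.logb 2 (c N).M₂ := by
    intro N
    constructor
    · rw [Real.le_logb_iff_rpow_le one_lt_two (by exact_mod_cast (c N).M₁_pos)]
      exact (hM N).1
    · rw [Real.le_logb_iff_rpow_le one_lt_two (by exact_mod_cast (c N).M₂_pos)]
      exact (hM N).2
  -- The threshold keeps 1 - 2 · error nonnegative, so the lower bounds on the message counts can be
  -- multiplied by it.
  have hsmall : ∀ᶠ N in atTop, (c N).errorProb ≤ 1 / 2 :=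
    herr.eventually (eventually_le_nhds (by norm_num))
  have e1 : Tendsto (fun N => 1 - (c N).errorProb) atTop (𝓝 1) := by
    simpa using herr.const_sub 1
  have e2 : Tendsto (fun N => 1 - 2 * (c N).errorProb) atTop (𝓝 1) := by
    simpa using (herr.const_mul 2).const_sub 1
  refine ⟨hR1, hR2, ?_, ?_, ?_⟩
  · have hl : Tendsto (fun N => (1 - (c N).errorProb) * R.1) atTop (𝓝 R.1) := by
      simpa using e1.mul_const R.1
    have hr : Tendsto (fun N : ℕ => (m : ℝ) + 1 / (N : ℝ)) atTop (𝓝 m) := by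
      simpa using hinv.const_add (m : ℝ)
    refine le_of_tendsto_of_tendsto hl hr ?_
    filter_upwards [hsmall, eventually_gt_atTop 0] with N h1 h2
    have hN : (0 : ℝ) < N := by exact_mod_cast h2
    have h3 := (c N).rate₁_bound
    have h4 := mul_le_mul_of_nonneg_left (hlog N).1 (show 0 ≤ 1 - (c N).errorProb by linarith)
    refine le_of_mul_le_mul_left ?_ hN
    rw [mul_add, mul_one_div_cancel hN.ne']
    linarith
  · have hl : Tendsto (fun N => (1 - (c N).errorProb) * R.2) atTop (𝓝 R.2) := by
      simpa using e1.mul_const R.2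
    have hr : Tendsto (fun N : ℕ => ((m - (n - m) : ℕ) : ℝ) + 1 / (N : ℝ) * (c N).leak₂ +
        1 / (N : ℝ)) atTop (𝓝 (m - (n - m) : ℕ)) := by
      simpa using (hleak.const_add ((m - (n - m) : ℕ) : ℝ)).add hinv
    refine le_of_tendsto_of_tendsto hl hr ?_
    filter_upwards [hsmall, eventually_gt_atTop 0] with N h1 h2
    have hN : (0 : ℝ) < N := by exact_mod_cast h2
    have h3 := (c N).rate₂_bound
    have h4 := mul_le_mul_of_nonneg_left (hlog N).2 (show 0 ≤ 1 - (c N).errorProb by linarith)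
    refine le_of_mul_le_mul_left ?_ hN
    rw [mul_add, mul_add, ← mul_assoc (N : ℝ) (1 / N), mul_one_div_cancel hN.ne']
    linarith
  · have hl : Tendsto (fun N => (1 - 2 * (c N).errorProb) * R.1 + (1 - (c N).errorProb) * R.2)
        atTop (𝓝 (R.1 + R.2)) := by
      simpa using (e2.mul_const R.1).add (e1.mul_const R.2)
    have hr : Tendsto (fun N : ℕ => ((m : ℝ) + (m - n : ℕ) + C) + 1 / (N : ℝ) * (c N).leak₂ +
        3 * (1 / (N : ℝ))) atTop (𝓝 (m + (m - n : ℕ) + C)) := by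
      simpa using (hleak.const_add ((m : ℝ) + (m - n : ℕ) + C)).add (hinv.const_mul 3)
    refine le_of_tendsto_of_tendsto hl hr ?_
    filter_upwards [hsmall, eventually_gt_atTop 0] with N h1 h2
    have hN : (0 : ℝ) < N := by exact_mod_cast h2
    have h3 := (c N).sum_rate_bound
    have h4 := mul_le_mul_of_nonneg_left (hlog N).1
      (show 0 ≤ 1 - 2 * (c N).errorProb by linarith)
    have h5 := mul_le_mul_of_nonneg_left (hlog N).2 (show 0 ≤ 1 - (c N).errorProb by linarith)
    have h6 : (N : ℝ) * (3 * (1 / N)) = 3 := by field_simp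
    refine le_of_mul_le_mul_left ?_ hN
    rw [mul_add, mul_add (N : ℝ) _ (3 * _), mul_add (N : ℝ) _ (_ * _), h6, ← mul_assoc (N : ℝ) (1 / N),
      mul_one_div_cancel hN.ne']
    linarith

theorem capacityWeak_subset_region (m n C : ℕ) : capacityWeak m n C ⊆ region m n C :=
  closure_minimal (fun _ => mem_region_of_achievable_weak) (isClosed_region m n C)


/-! ### Linear codes with jamming and cooperative precoding -/

section SlotCode

variable {m n C N : ℕ}

/-- The block which carries the bits `w` on the slots of `T` and agrees with `u` on the others. -/
def spread (T : Finset (Fin N × Fin m)) (w : T → ZMod 2) (u : Fin N → Fin m → ZMod 2) :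
    Fin N → Fin m → ZMod 2 :=
  fun t i => if h : (t, i) ∈ T then w ⟨(t, i), h⟩ else u t i

/-- The level of `x₂` which interferes with the level `i` of `x₁` (when `n ≤ m`, it exists only for
`m - n ≤ i`). -/
def facing (m n i : ℕ) : ℕ := i + (max m n - m) - (max m n - n)

/-- The correction added by transmitter 1, which cancels the interference on the levels known
through the cooperative link. -/
def precoding (m n : ℕ) (v : Fin C → ZMod 2) (i : Fin m) : ZMod 2 :=
  if h : max m n - n ≤ i + (max m n - m) ∧ n - m ≤ facing m n i ∧ facing m n i - (n - m) < C then
    v ⟨facing m n i - (n - m), h.2.2⟩ else 0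

/-- The cooperative signal: the first `C` levels of `x` which receiver 1 does not see in the
clear. -/
def shared (n C : ℕ) (x : Fin m → ZMod 2) : Fin C → ZMod 2 :=
  fun j => if h : n - m + (j : ℕ) < m then x ⟨n - m + j, h⟩ else 0

/-- The part of the output at receiver 1 which is due to the signal `x` of transmitter 2, as a
perturbation of the input of transmitter 1. -/
def residual (n C : ℕ) (x : Fin m → ZMod 2) (i : Fin m) : ZMod 2 :=
  precoding m n (shared n C x) i +
    if _h : max m n - n ≤ i + (max m n - m) then
      pad (max m n) x ⟨facing m n i, by unfold facing; omega⟩ else 0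

/-- With user 2 silent on its exposed levels, the interference only adds a perturbation to the input
of transmitter 1. This is what lets that input mask it. -/
theorem output₁_precoding (x₁ x : Fin m → ZMod 2) (hx : ∀ i : Fin m, (i : ℕ) < n - m → x i = 0)
    (j : Fin (max m n)) :
    output₁ m n (fun i => x₁ i + precoding m n (shared n C x) i) (pad (max m n) x) j =
      if h : max m n - m ≤ (j : ℕ) then
        x₁ ⟨j - (max m n - m), by omega⟩ + residual n C x ⟨j - (max m n - m), by omega⟩ else 0 := by
  rw [output₁_apply]
  by_cases h : max m n - m ≤ (j : ℕ)
  · rw [dif_pos h, dif_pos h, residual, add_assoc]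
    have h' : (j : ℕ) - (max m n - m) + (max m n - m) = j := by omega
    simp only [facing, h']
  · rw [dif_neg h, dif_neg h, zero_add, dif_pos (by omega), pad]
    split_ifs with h'
    · exact hx _ (by simp; omega)
    · rfl

/-- Either the facing level carries nothing, or its bit is known over the link and is added twice in
characteristic 2. -/
theorem residual_eq_zero (x : Fin m → ZMod 2) (i : Fin m)
    (hx : ∀ l : Fin m, (i : ℕ) + (max m n - m) = l + (max m n - n) →
      x l = 0 ∨ (n - m ≤ (l : ℕ) ∧ (l : ℕ) < n - m + C)) :
    residual n C x i = 0 := by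
  unfold residual
  by_cases h0 : max m n - n ≤ i + (max m n - m)
  swap
  · rw [precoding, dif_neg (fun h => h0 h.1), dif_neg h0, add_zero]
  rw [dif_pos h0]
  have hf : (i : ℕ) + (max m n - m) = facing m n i + (max m n - n) := by unfold facing; omega
  by_cases hm : facing m n i < m
  · have hp : pad (max m n) x ⟨facing m n i, by omega⟩ = x ⟨facing m n i, hm⟩ := by
      rw [pad, dif_pos hm]
    rw [hp]
    by_cases hc : n - m ≤ facing m n i ∧ facing m n i < n - m + C
    · rw [precoding, dif_pos ⟨h0, hc.1, by omega⟩, shared, dif_pos (by simp; omega)]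
      have : n - m + (facing m n i - (n - m)) = facing m n i := by omega
      simp only [this]
      exact CharTwo.add_self_eq_zero _
    · rw [precoding, dif_neg (by omega), zero_add]
      exact (hx ⟨_, hm⟩ hf).resolve_right hc
  · have hp : pad (max m n) x ⟨facing m n i, by omega⟩ = 0 := by rw [pad, dif_neg hm]
    rw [hp, add_zero, precoding]
    split_ifs with h
    · rw [shared, dif_neg (by simp; omega)]
    · rfl

/-- The enumeration of a finite type. -/
noncomputable def enum (α : Type*) [Fintype α] : Fin (Fintype.card α) ≃ α :=
  (Fintype.equivFin α).symm

/-- The code which sends the bits of the messages on the slots `T₁` and `T₂`, jams with uniform bits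
on the remaining slots of transmitter 1, and cancels the interference which is known through the
cooperative link. -/
noncomputable def slotCode (n C : ℕ) (T₁ T₂ : Finset (Fin N × Fin m)) : Code m n C N where
  M₁ := Fintype.card (T₁ → ZMod 2)
  M₂ := Fintype.card (T₂ → ZMod 2)
  M₁_pos := Fintype.card_pos
  M₂_pos := Fintype.card_pos
  K₁ := Fintype.card (Fin N → Fin m → ZMod 2)
  K₂ := 1
  ρ₁ _ := 1 / (Fintype.card (Fin N → Fin m → ZMod 2) : ℝ)
  ρ₂ _ := 1
  ρ₁_mem := ⟨fun _ => by positivity, by simp⟩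
  ρ₂_mem := ⟨fun _ => by simp, by simp⟩
  coop w _ t := shared n C (spread T₂ (enum _ w) 0 t)
  enc₂ w _ t := pad (max m n) (spread T₂ (enum _ w) 0 t)
  enc₁ w k v t i := spread T₁ (enum _ w) (enum _ k) t i + precoding m n (v t) i
  causal w k v v' t h := by simp only [h t le_rfl]
  dec₁ y := (enum _).symm fun s => y s.1.1 ⟨s.1.2 + (max m n - m), by have := s.1.2.isLt; omega⟩
  dec₂ y := (enum _).symm fun s => y s.1.1 s.1.2

variable (T₁ T₂ : Finset (Fin N × Fin m))

/-- The message of user 1 as bits on the slots `T₁`. -/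
noncomputable def bits₁ (n C : ℕ) (T₁ T₂ : Finset (Fin N × Fin m)) :
    Fin (slotCode n C T₁ T₂).M₁ ≃ (T₁ → ZMod 2) := enum (T₁ → ZMod 2)

/-- The message of user 2 as bits on the slots `T₂`. -/
noncomputable def bits₂ (n C : ℕ) (T₁ T₂ : Finset (Fin N × Fin m)) :
    Fin (slotCode n C T₁ T₂).M₂ ≃ (T₂ → ZMod 2) := enum (T₂ → ZMod 2)

/-- The jamming signal of transmitter 1. -/
noncomputable def jam (n C : ℕ) (T₁ T₂ : Finset (Fin N × Fin m)) :
    Fin (slotCode n C T₁ T₂).K₁ ≃ (Fin N → Fin m → ZMod 2) := enum (Fin N → Fin m → ZMod 2)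

theorem slotCode_M₁ : (slotCode n C T₁ T₂).M₁ = 2 ^ T₁.card := by simp [slotCode]

theorem slotCode_M₂ : (slotCode n C T₁ T₂).M₂ = 2 ^ T₂.card := by simp [slotCode]

theorem spread_zero_eq_zero {T : Finset (Fin N × Fin m)} {w : T → ZMod 2} {t : Fin N} {i : Fin m}
    (h : (t, i) ∉ T) : spread T w 0 t i = 0 := by
  simp [spread, h]

theorem slotCode_X₁ (ω : (slotCode n C T₁ T₂).Ω) (t : Fin N) :
    (slotCode n C T₁ T₂).X₁ ω t = fun i =>
      spread T₁ (bits₁ n C T₁ T₂ ω.1) (jam n C T₁ T₂ ω.2.2.1) t i +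
        precoding m n (shared n C (spread T₂ (bits₂ n C T₁ T₂ ω.2.1) 0 t)) i := rfl

theorem slotCode_X₂ (ω : (slotCode n C T₁ T₂).Ω) (t : Fin N) :
    (slotCode n C T₁ T₂).X₂ ω t =
      pad (max m n) (spread T₂ (bits₂ n C T₁ T₂ ω.2.1) 0 t) := rfl

theorem slotCode_Y₁ (hT : ∀ s ∈ T₂, n - m ≤ (s.2 : ℕ)) (ω : (slotCode n C T₁ T₂).Ω) (t : Fin N)
    (j : Fin (max m n)) :
    (slotCode n C T₁ T₂).Y₁ ω t j =
      if h : max m n - m ≤ (j : ℕ) then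
        spread T₁ (bits₁ n C T₁ T₂ ω.1) (jam n C T₁ T₂ ω.2.2.1) t
            ⟨j - (max m n - m), by omega⟩ +
          residual n C (spread T₂ (bits₂ n C T₁ T₂ ω.2.1) 0 t) ⟨j - (max m n - m), by omega⟩
      else 0 := by
  rw [Code.Y₁, slotCode_X₁, slotCode_X₂]
  refine output₁_precoding _ _ (fun i hi => spread_zero_eq_zero fun h => ?_) j
  have := hT _ h
  simp only at this
  omega

/-- `Y₂` is a function of the data of user 2 alone, which are independent of `W₁`; this holds for
every code. -/
theorem Code.leak₁_eq_zero (c : Code m n C N) : c.leak₁ = 0 := by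
  have h : entropy c.pmf (fun ω => (c.W₁ ω, c.Y₂ ω)) = entropy c.pmf c.W₁ + entropy c.pmf c.Y₂ :=
    c.entropy_users Prod.fst fun z t => output₂ m n (c.enc₂ z.1 z.2 t)
  rw [leak₁, mutualInfo, h, sub_self]

/-- The coordinates of the sample space in which the data of user 1 include the interference. -/
noncomputable def slotCodeEquiv (n C : ℕ) (T₁ T₂ : Finset (Fin N × Fin m))
    (d : (T₂ → ZMod 2) → Fin N → Fin m → ZMod 2) : (slotCode n C T₁ T₂).Ω ≃
      (Fin (slotCode n C T₁ T₂).M₂ × Fin (slotCode n C T₁ T₂).K₂) ×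
        ((T₁ → ZMod 2) × (Fin N → Fin m → ZMod 2)) where
  toFun ω := ((ω.2.1, ω.2.2.2),
    (bits₁ n C T₁ T₂ ω.1 + fun s => d (bits₂ n C T₁ T₂ ω.2.1) s.1.1 s.1.2,
      jam n C T₁ T₂ ω.2.2.1 + d (bits₂ n C T₁ T₂ ω.2.1)))
  invFun z := ((bits₁ n C T₁ T₂).symm
      (z.2.1 - fun s => d (bits₂ n C T₁ T₂ z.1.1) s.1.1 s.1.2), z.1.1,
    (jam n C T₁ T₂).symm (z.2.2 - d (bits₂ n C T₁ T₂ z.1.1)), z.1.2)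
  left_inv ω := by simp
  right_inv z := by simp

/-- Perfect secrecy by change of variables: in the new coordinates the data of user 2 and the factor
that determines `Y₁` are independent. -/
theorem Code.leak₂_eq_zero_of_equiv (c : Code m n C N) {B : Type*} [Fintype B]
    (e : c.Ω ≃ (Fin c.M₂ × Fin c.K₂) × B) (p₂ : B → ℝ) (hp₂ : ∑ b, p₂ b = 1)
    (he : ∀ ω, (e ω).1 = (ω.2.1, ω.2.2.2))
    (hp : ∀ ω, 1 / (c.M₁ : ℝ) * c.ρ₁ ω.2.2.1 = p₂ (e ω).2)
    (g : B → Fin N → Fin (max m n) → ZMod 2) (hY : ∀ ω, c.Y₁ ω = g (e ω).2) : c.leak₂ = 0 := by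
  have h := entropy_pair_eq_add e c.pmf_nonneg c.sum_user₂ hp₂
    (fun ω => by rw [c.pmf_eq_mul, mul_comm, he, hp]) Prod.fst g c.W₂ c.Y₁
    (fun ω => by rw [he]; rfl) hY
  rw [leak₂, mutualInfo, h, sub_self]

theorem slotCode_leak₂ (hT : ∀ s ∈ T₂, n - m ≤ (s.2 : ℕ)) : (slotCode n C T₁ T₂).leak₂ = 0 := by
  -- One-time pad: translating the uniform message bits and jamming bits by the residual
  -- interference preserves their law, and `Y₁` depends only on the translated bits.
  set d : (T₂ → ZMod 2) → Fin N → Fin m → ZMod 2 :=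
    fun w t => residual n C (spread T₂ w 0 t) with hd
  refine Code.leak₂_eq_zero_of_equiv _ (slotCodeEquiv n C T₁ T₂ d)
    (fun _ => 1 / (Fintype.card (T₁ → ZMod 2) : ℝ) *
        (1 / (Fintype.card (Fin N → Fin m → ZMod 2) : ℝ))) ?_ (fun ω => rfl) (fun ω => rfl)
    (fun z t j => if h : max m n - m ≤ (j : ℕ) then
        spread T₁ z.1 z.2 t ⟨j - (max m n - m), by omega⟩ else 0) fun ω => ?_
  · rw [Finset.sum_const, Finset.card_univ, Fintype.card_prod, nsmul_eq_mul, Nat.cast_mul]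
    have h1 : (Fintype.card (T₁ → ZMod 2) : ℝ) ≠ 0 := by
      exact_mod_cast Fintype.card_ne_zero
    have h2 : (Fintype.card (Fin N → Fin m → ZMod 2) : ℝ) ≠ 0 := by
      exact_mod_cast Fintype.card_ne_zero
    field_simp
  · funext t j
    rw [slotCode_Y₁ T₁ T₂ hT]
    by_cases h : max m n - m ≤ (j : ℕ)
    · simp only [dif_pos h, spread, slotCodeEquiv, Equiv.coe_fn_mk, Pi.add_apply, hd]
      split_ifs <;> rfl
    · simp only [dif_neg h]

/-- By `hcomp`, a slot of user 1 that faces an active slot of user 2 has its interference cancelled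
through the link. -/
theorem slotCode_errorProb (hT : ∀ s ∈ T₂, n - m ≤ (s.2 : ℕ))
    (hcomp : ∀ t i l, (t, i) ∈ T₁ → (t, l) ∈ T₂ →
      (i : ℕ) + (max m n - m) = l + (max m n - n) → (l : ℕ) < n - m + C) :
    (slotCode n C T₁ T₂).errorProb = 0 := by
  refine Finset.sum_eq_zero fun ω _ => if_neg ?_
  rw [not_or, not_not, not_not]
  constructor
  · refine (Equiv.symm_apply_eq (bits₁ n C T₁ T₂)).2 (funext fun s => ?_)
    rw [slotCode_Y₁ T₁ T₂ hT, dif_pos (by simp)]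
    simp only [Nat.add_sub_cancel, Fin.eta]
    rw [residual_eq_zero, add_zero, spread, dif_pos s.2]
    · rfl
    · intro l hl
      by_cases hmem : (s.1.1, l) ∈ T₂
      · exact Or.inr ⟨hT _ hmem, hcomp _ _ _ s.2 hmem hl⟩
      · exact Or.inl (spread_zero_eq_zero hmem)
  · refine (Equiv.symm_apply_eq (bits₂ n C T₁ T₂)).2 (funext fun s => ?_)
    have h : (slotCode n C T₁ T₂).Y₂ ω s.1.1 s.1.2 =
        pad (max m n) (spread T₂ (bits₂ n C T₁ T₂ ω.2.1) 0 s.1.1)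
          ⟨s.1.2, s.1.2.isLt.trans_le (le_max_left m n)⟩ := output₂_apply _ _
    rw [h, pad, dif_pos s.1.2.isLt, spread, dif_pos s.2]
    rfl

end SlotCode

/-! ### The choice of the slots -/

theorem card_slots {N m : ℕ} (a b : ℕ) (hb : b ≤ m) :
    (Finset.univ.filter fun s : Fin N × Fin m => a ≤ (s.2 : ℕ) ∧ (s.2 : ℕ) < b).card =
      N * (b - a) := by
  have h1 : (Finset.univ.filter fun s : Fin N × Fin m => a ≤ (s.2 : ℕ) ∧ (s.2 : ℕ) < b) =
      (Finset.univ : Finset (Fin N)) ×ˢ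
        (Finset.univ.filter fun i : Fin m => a ≤ (i : ℕ) ∧ (i : ℕ) < b) := by
    ext s
    simp
  have h2 : ((Finset.univ.filter fun i : Fin m => a ≤ (i : ℕ) ∧ (i : ℕ) < b).map
      Fin.valEmbedding) = Finset.Ico a b := by
    ext k
    simp only [Finset.mem_map, Finset.mem_filter, Finset.mem_univ, true_and,
      Fin.valEmbedding_apply, Finset.mem_Ico]
    exact ⟨fun ⟨i, hi, hk⟩ => hk ▸ hi, fun hk => ⟨⟨k, by omega⟩, hk, rfl⟩⟩
  rw [h1, Finset.card_product, Finset.card_univ, Fintype.card_fin,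
    ← Finset.card_map Fin.valEmbedding, h2, Nat.card_Ico]

/-- The number of levels on which the two users are in conflict. -/
def conflicts (m n C : ℕ) : ℕ := min m n - (n - m + C)

/-- Of the conflicting slots, user 2 gives up r (the set `Q`), and user 1 gives up the slots facing
the others. The choice is made over the whole block, so r need not be a multiple of N. -/
theorem exists_slots (m n C N r : ℕ) (hr : r ≤ N * conflicts m n C) :
    ∃ T₁ T₂ : Finset (Fin N × Fin m), (∀ s ∈ T₂, n - m ≤ (s.2 : ℕ)) ∧
      (∀ t i l, (t, i) ∈ T₁ → (t, l) ∈ T₂ →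
        (i : ℕ) + (max m n - m) = l + (max m n - n) → (l : ℕ) < n - m + C) ∧
      N * m + r ≤ T₁.card + N * conflicts m n C ∧ N * (m - (n - m)) ≤ T₂.card + r := by
  set P : Finset (Fin N × Fin m) :=
    Finset.univ.filter fun s => n - m + C ≤ (s.2 : ℕ) ∧ (s.2 : ℕ) < min m n with hP
  have hPc : P.card = N * conflicts m n C := card_slots _ _ (min_le_left _ _)
  obtain ⟨Q, hQ, hQr⟩ := Finset.exists_subset_card_eq (hPc ▸ hr)
  set A : Finset (Fin N × Fin m) :=
    Finset.univ.filter fun s => n - m ≤ (s.2 : ℕ) ∧ (s.2 : ℕ) < m with hA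
  have hAc : A.card = N * (m - (n - m)) := card_slots _ _ le_rfl
  -- The slot of x₁ hit by a slot of x₂; the default is never reached on conflicting slots.
  set ι : Fin N × Fin m → Fin N × Fin m := fun s =>
    (s.1, if h : (s.2 : ℕ) + (max m n - n) - (max m n - m) < m then ⟨_, h⟩ else s.2) with hι
  refine ⟨Finset.univ \ (P \ Q).image ι, A \ Q, ?_, ?_, ?_, ?_⟩
  · intro s hs
    exact (Finset.mem_filter.1 (Finset.mem_sdiff.1 hs).1).2.1
  · intro t i l hi hl hil
    by_contra! hlt
    rw [Finset.mem_sdiff] at hi hl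
    refine hi.2 (Finset.mem_image.2 ⟨(t, l), ?_, ?_⟩)
    · rw [Finset.mem_sdiff]
      refine ⟨Finset.mem_filter.2 ⟨Finset.mem_univ _, hlt, ?_⟩, hl.2⟩
      simp only
      omega
    · simp only [hι]
      rw [dif_pos (by omega)]
      congr 1
      exact Fin.ext (by simp; omega)
  · have h1 := Finset.le_card_sdiff ((P \ Q).image ι) Finset.univ
    have h2 : ((P \ Q).image ι).card ≤ _ := Finset.card_image_le
    have h3 := Finset.card_sdiff_add_card_eq_card hQ
    have h4 : (Finset.univ : Finset (Fin N × Fin m)).card = N * m := by simp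
    omega
  · have h1 := Finset.le_card_sdiff Q A
    omega

open Filter Topology in
/-- Rate pairs in the interior of the sum-rate constraint are achievable with perfect secrecy and no
error for large block lengths. -/
theorem achievable_perfect {m n C : ℕ} {R : ℝ × ℝ} (h1 : 0 ≤ R.1) (h2 : 0 ≤ R.2) (h1m : R.1 ≤ m)
    (h2m : R.2 ≤ (m - (n - m) : ℕ))
    (hsum : R.1 = 0 ∨ R.1 + R.2 < m + (m - (n - m) : ℕ) - conflicts m n C) :
    Achievable (PerfectSecrecy (m := m) (n := n) (C := C)) R := by
  have hconf : conflicts m n C ≤ m := by unfold conflicts; omega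
  have hconf' : (conflicts m n C : ℝ) ≤ m := by exact_mod_cast hconf
  have hslots : ∀ᶠ N : ℕ in atTop, ∃ T₁ T₂ : Finset (Fin N × Fin m),
      ((∀ s ∈ T₂, n - m ≤ (s.2 : ℕ)) ∧ N * R.1 ≤ T₁.card ∧ N * R.2 ≤ T₂.card) ∧
      ∀ t i l, (t, i) ∈ T₁ → (t, l) ∈ T₂ →
        (i : ℕ) + (max m n - m) = l + (max m n - n) → (l : ℕ) < n - m + C := by
    -- The slack in the sum rate, once N times it reaches one slot, absorbs the rounding in `⌈x⌉₊`.
    -- If R₁ = 0 then x ≤ 0 and nothing is rounded.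
    have hlarge : ∀ᶠ N : ℕ in atTop, R.1 = 0 ∨
        1 ≤ (N : ℝ) * (m + (m - (n - m) : ℕ) - conflicts m n C - (R.1 + R.2)) := by
      rcases hsum with h | h
      · exact Eventually.of_forall fun _ => Or.inl h
      · filter_upwards [(tendsto_natCast_atTop_atTop.atTop_mul_const
          (sub_pos.2 h)).eventually_ge_atTop (1 : ℝ)] with N hN using Or.inr hN
    filter_upwards [hlarge] with N hN
    have hN0 : (0 : ℝ) ≤ N := Nat.cast_nonneg N
    -- The number of conflicting slots that user 1 needs beyond its conflict-free ones.
    set x : ℝ := N * (R.1 - m + conflicts m n C) with hx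
    have hr : ⌈x⌉₊ ≤ N * conflicts m n C := by
      rw [Nat.ceil_le, hx]
      push_cast
      exact mul_le_mul_of_nonneg_left (by linarith) hN0
    obtain ⟨T₁, T₂, hT, hcomp, hc1, hc2⟩ := exists_slots m n C N _ hr
    have hc1' : (N : ℝ) * m + ⌈x⌉₊ ≤ T₁.card + N * conflicts m n C := by exact_mod_cast hc1
    have hc2' : (N : ℝ) * (m - (n - m) : ℕ) ≤ T₂.card + ⌈x⌉₊ := by exact_mod_cast hc2
    refine ⟨T₁, T₂, ⟨hT, ?_, ?_⟩, hcomp⟩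
    · have := Nat.le_ceil x
      rw [hx] at this hc1'
      linarith
    · by_cases hx0 : x ≤ 0
      · rw [Nat.ceil_eq_zero.2 hx0] at hc2'
        have := mul_le_mul_of_nonneg_left h2m hN0
        push_cast at hc2'
        linarith
      · push Not at hx0
        have hlt := Nat.ceil_lt_add_one hx0.le
        rcases hN with hN | hN
        · rw [hx, hN] at hx0
          have := mul_nonneg hN0 (show 0 ≤ (m : ℝ) - conflicts m n C by linarith)
          linarith
        · rw [hx] at hlt hc2'
          linarith
  -- Rates and secrecy are required at every block length, but reliability only in the limit: for
  -- small N all permitted slots are used, with decoding errors allowed.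
  have hall : ∀ N : ℕ, ∃ T₁ T₂ : Finset (Fin N × Fin m),
      (∀ s ∈ T₂, n - m ≤ (s.2 : ℕ)) ∧ N * R.1 ≤ T₁.card ∧ N * R.2 ≤ T₂.card := by
    intro N
    have hN0 : (0 : ℝ) ≤ N := Nat.cast_nonneg N
    refine ⟨Finset.univ, Finset.univ.filter fun s => n - m ≤ (s.2 : ℕ) ∧ (s.2 : ℕ) < m,
      fun s hs => (Finset.mem_filter.1 hs).2.1, ?_, ?_⟩
    · simpa using mul_le_mul_of_nonneg_left h1m hN0
    · rw [card_slots _ _ le_rfl, Nat.cast_mul]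
      exact mul_le_mul_of_nonneg_left h2m hN0
  have hchoice : ∀ N : ℕ, ∃ T : Finset (Fin N × Fin m) × Finset (Fin N × Fin m),
      ((∀ s ∈ T.2, n - m ≤ (s.2 : ℕ)) ∧ N * R.1 ≤ T.1.card ∧ N * R.2 ≤ T.2.card) ∧
      ((∃ T₁ T₂ : Finset (Fin N × Fin m),
        ((∀ s ∈ T₂, n - m ≤ (s.2 : ℕ)) ∧ N * R.1 ≤ T₁.card ∧ N * R.2 ≤ T₂.card) ∧
        ∀ t i l, (t, i) ∈ T₁ → (t, l) ∈ T₂ →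
          (i : ℕ) + (max m n - m) = l + (max m n - n) → (l : ℕ) < n - m + C) →
        ∀ t i l, (t, i) ∈ T.1 → (t, l) ∈ T.2 →
          (i : ℕ) + (max m n - m) = l + (max m n - n) → (l : ℕ) < n - m + C) := by
    intro N
    by_cases h : ∃ T₁ T₂ : Finset (Fin N × Fin m),
        ((∀ s ∈ T₂, n - m ≤ (s.2 : ℕ)) ∧ N * R.1 ≤ T₁.card ∧ N * R.2 ≤ T₂.card) ∧
        ∀ t i l, (t, i) ∈ T₁ → (t, l) ∈ T₂ →
          (i : ℕ) + (max m n - m) = l + (max m n - n) → (l : ℕ) < n - m + C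
    · obtain ⟨T₁, T₂, hT, hcomp⟩ := h
      exact ⟨(T₁, T₂), hT, fun _ => hcomp⟩
    · obtain ⟨T₁, T₂, hT⟩ := hall N
      exact ⟨(T₁, T₂), hT, fun h' => (h h').elim⟩
  choose T hT hcomp using hchoice
  refine ⟨h1, h2, fun N => slotCode n C (T N).1 (T N).2, fun N => ?_, ?_, fun N => ?_⟩
  · rw [slotCode_M₁, slotCode_M₂]
    push_cast
    rw [← Real.rpow_natCast, ← Real.rpow_natCast]
    exact ⟨Real.rpow_le_rpow_of_exponent_le one_le_two (hT N).2.1,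
      Real.rpow_le_rpow_of_exponent_le one_le_two (hT N).2.2⟩
  · refine tendsto_const_nhds.congr' ?_
    filter_upwards [hslots] with N hN
    exact (slotCode_errorProb _ _ (hT N).1 (hcomp N hN)).symm
  · exact ⟨Code.leak₁_eq_zero _, slotCode_leak₂ _ _ (hT N).1⟩

/-- If there are conflicts, the right side equals the sum-rate bound of `region`; if there are none,
the individual bounds suffice. -/
theorem sum_rate_le_slots {m n C : ℕ} {R : ℝ × ℝ} (hR : R ∈ region m n C) :
    R.1 + R.2 ≤ m + (m - (n - m) : ℕ) - conflicts m n C := by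
  obtain ⟨-, -, h1, h2, h3⟩ := hR
  by_cases h : conflicts m n C = 0
  · rw [h]
    push_cast
    linarith
  · have : m + (m - n) + C + conflicts m n C = m + (m - (n - m)) := by
      unfold conflicts at h ⊢
      omega
    have : (m : ℝ) + (m - n : ℕ) + C + conflicts m n C = m + (m - (n - m) : ℕ) := by
      exact_mod_cast this
    linarith

open Filter Topology in
theorem region_subset_capacityPerfect (m n C : ℕ) : region m n C ⊆ capacityPerfect m n C := by
  intro R hR
  have hlim : Tendsto (fun θ : ℝ => θ • R) (𝓝[<] 1) (𝓝 R) := by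
    have : Tendsto (fun θ : ℝ => θ • R) (𝓝 1) (𝓝 ((1 : ℝ) • R)) :=
      (continuous_id.smul continuous_const).tendsto 1
    rw [one_smul] at this
    exact this.mono_left nhdsWithin_le_nhds
  refine mem_closure_of_tendsto hlim ?_
  filter_upwards [Ioo_mem_nhdsLT (zero_lt_one' ℝ)] with θ hθ
  have hs := sum_rate_le_slots hR
  obtain ⟨h1, h2, h3, h4, -⟩ := hR
  have hle : ∀ x : ℝ, 0 ≤ x → θ * x ≤ x := fun x hx => mul_le_of_le_one_left hx hθ.2.le
  refine achievable_perfect (mul_nonneg hθ.1.le h1) (mul_nonneg hθ.1.le h2) ((hle _ h1).trans h3)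
    ((hle _ h2).trans h4) ?_
  -- Shrinking by θ makes the sum bound strict when R₁ > 0; when R₁ = 0 strictness may fail, for
  -- instance at the origin with m = 0, but is not needed.
  rcases h1.eq_or_lt with h0 | h0
  · left
    simp [← h0]
  · right
    refine lt_of_lt_of_le ?_ hs
    exact add_lt_add_of_lt_of_le (mul_lt_of_lt_one_left h0 hθ.2) (hle _ h2)

/-! ### Comparison of the secrecy constraints -/

theorem capacityPerfect_subset_capacityStrong (m n C : ℕ) :
    capacityPerfect m n C ⊆ capacityStrong m n C := by
  refine closure_mono fun R ⟨h1, h2, c, hM, he, hs⟩ => ⟨h1, h2, c, hM, he, ?_⟩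
  constructor
  · simpa only [(hs _).1] using tendsto_const_nhds
  · simpa only [(hs _).2] using tendsto_const_nhds

theorem capacityStrong_subset_capacityWeak (m n C : ℕ) :
    capacityStrong m n C ⊆ capacityWeak m n C := by
  have hinv : Filter.Tendsto (fun N : ℕ => 1 / (N : ℝ)) Filter.atTop (nhds 0) :=
    tendsto_const_div_atTop_nhds_zero_nat 1
  refine closure_mono fun R ⟨h1, h2, c, hM, he, hs⟩ => ⟨h1, h2, c, hM, he, ?_⟩
  constructor
  · simpa using hinv.mul hs.1
  · simpa using hinv.mul hs.2

end ZIC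

theorem theorem4 (m n C : ℕ) :
    ZIC.capacityPerfect m n C = ZIC.capacityStrong m n C ∧
      ZIC.capacityStrong m n C = ZIC.capacityWeak m n C := by
  have h1 := ZIC.capacityPerfect_subset_capacityStrong m n C
  have h2 := ZIC.capacityStrong_subset_capacityWeak m n C
  have h3 := (ZIC.capacityWeak_subset_region m n C).trans (ZIC.region_subset_capacityPerfect m n C)
  exact ⟨h1.antisymm (h2.trans h3), h2.antisymm (h3.trans h1)⟩
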